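/- For positive semidefinite $n\times n$ complex matrices $A,B$ let $d(A,B)=\bigl[\operatorname{tr}A+\operatorname{tr}B-2\operatorname{tr}\,(A^{1/2}BA^{1/2})^{1/2}\bigr]^{1/2}$ be the Bures–Wasserstein distance, where $A^{1/2}$ is the positive semidefinite square root. Let $A_1,\dots,A_m$ be positive definite $n\times n$ complex matrices and let $w=(w_1,\dots,w_m)$ be a weight vector, i.e. $w_j>0$ for all $j$ and $\sum_{j=1}^m w_j=1$. Then the problem of minimising $\sum_{j=1}^m w_j\,d^2(X,A_j)$ over all positive definite matrices $X$ has a unique solution, the Wasserstein barycentre $\Omega(w;A_1,\dots,A_m)$, and $$\Omega(w;A_1,\dots,A_m)\;\le\;\sum_{j=1}^m w_jA_j$$ in the Loewner order (i.e. the right side minus the left side is positive semidefinite). -/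

import Mathlib

open scoped ComplexOrder MatrixOrder

noncomputable section

/-- The Bures–Wasserstein distance
`d(A,B) = [tr A + tr B - 2 tr (A^{1/2} B A^{1/2})^{1/2}]^{1/2}` between positive semidefinite
complex matrices; `CFC.sqrt` is the positive semidefinite square root. The traces are real and the
bracket is nonnegative for positive semidefinite `A` and `B`. -/
def buresDist {n : ℕ} (A B : Matrix (Fin n) (Fin n) ℂ) : ℝ :=
  Real.sqrt (A.trace.re + B.trace.re
    - 2 * (CFC.sqrt (CFC.sqrt A * B * CFC.sqrt A)).trace.re)

/-- `X` solves the minimisation problem `min_{X > 0} ∑ j, w j * d(X, A j) ^ 2`, the minimum being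
over all positive definite matrices. -/
def IsWassersteinMinimiser {n m : ℕ} (w : Fin m → ℝ) (A : Fin m → Matrix (Fin n) (Fin n) ℂ)
    (X : Matrix (Fin n) (Fin n) ℂ) : Prop :=
  X.PosDef ∧ ∀ Y : Matrix (Fin n) (Fin n) ℂ, Y.PosDef →
    ∑ j, w j * buresDist X (A j) ^ 2 ≤ ∑ j, w j * buresDist Y (A j) ^ 2

/-- The Wasserstein barycentre `Ω(w; A_1, …, A_m)`: the minimiser of
`∑ j, w j * d(X, A j) ^ 2` over positive definite `X`
(an unspecified matrix if there were no minimiser). -/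
def wassersteinBarycentre {n m : ℕ} (w : Fin m → ℝ) (A : Fin m → Matrix (Fin n) (Fin n) ℂ) :
    Matrix (Fin n) (Fin n) ℂ :=
  Classical.epsilon (IsWassersteinMinimiser w A)

end

/-! The proof is by duality. Twice the fidelity of `X` and `A` is at most `tr (X T) + tr (A T⁻¹)`
for every `T > 0`, with equality iff `T X T = A` (`two_mul_re_trace_sqrt_eq_iff`). If `∑ w j • T j =
1`, averaging cancels `tr Y` and bounds the objective at `Y` below by `∑ w j (tr A j - tr (A j (T
j)⁻¹))`, free of `Y`. The best bound minimises `∑ w j tr (A j (T j)⁻¹)`. At a minimiser,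
stationarity forces all `(T j)⁻¹ A j (T j)⁻¹` to be one matrix `X`, so `X` attains the bound; the
equality case gives uniqueness. The Loewner bound is `0 ≤ ∑ w j (T j - 1) X (T j - 1) = ∑ w j A j -
X`. -/

namespace Matrix

/-! ### Variational formula for the fidelity -/

section Fidelity

variable {ι : Type*} [Fintype ι] [DecidableEq ι]

lemma PosDef.cfcSqrt {X : Matrix ι ι ℂ} (hX : X.PosDef) : (CFC.sqrt X).PosDef := by
  rw [(nonneg_iff_posSemidef.1 (CFC.sqrt_nonneg X)).posDef_iff_isUnit]
  have hu := hX.isUnit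
  rw [← CFC.sqrt_mul_sqrt_self X hX.posSemidef.nonneg] at hu
  exact isUnit_of_mul_isUnit_left hu

lemma PosDef.mul_mul_self {R T : Matrix ι ι ℂ} (hR : R.PosDef) (hT : T.PosDef) :
    (R * T * R).PosDef := by
  have h := (IsUnit.posDef_star_left_conjugate_iff (x := T) hR.isUnit).2 hT
  rwa [star_eq_conjTranspose, hR.isHermitian.eq] at h

/-- Completing the square: with `S = X^{1/2} T X^{1/2}` and `M² = X^{1/2} A X^{1/2}`, `(S - M) S⁻¹
(S - M) = S - 2 M + M S⁻¹ M`, and cyclicity of the trace does the rest. -/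
lemma trace_mul_add_trace_mul_inv_sub_two_mul_trace_sqrt {X A T : Matrix ι ι ℂ}
    (hX : X.PosDef) (hA : A.PosDef) (hT : T.PosDef) :
    (X * T).trace + (A * T⁻¹).trace - 2 * (CFC.sqrt (CFC.sqrt X * A * CFC.sqrt X)).trace =
    ((CFC.sqrt X * T * CFC.sqrt X - CFC.sqrt (CFC.sqrt X * A * CFC.sqrt X)) *
      (CFC.sqrt X * T * CFC.sqrt X)⁻¹ *
      (CFC.sqrt X * T * CFC.sqrt X - CFC.sqrt (CFC.sqrt X * A * CFC.sqrt X))).trace := by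
  have hR := hX.cfcSqrt
  have hRR := CFC.sqrt_mul_sqrt_self X hX.posSemidef.nonneg
  have hS := hR.mul_mul_self hT
  have hMM := CFC.sqrt_mul_sqrt_self _ (hR.mul_mul_self hA).posSemidef.nonneg
  generalize CFC.sqrt (CFC.sqrt X * A * CFC.sqrt X) = M at *
  generalize CFC.sqrt X = R at *
  have hRu := (isUnit_iff_isUnit_det _).1 hR.isUnit
  have hSu := (isUnit_iff_isUnit_det _).1 hS.isUnit
  have e1 : (X * T).trace = (R * T * R).trace := by
    rw [← hRR, trace_mul_cycle R T R]
  have e2 : (A * T⁻¹).trace = (M * (R * T * R)⁻¹ * M).trace := by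
    rw [trace_mul_cycle, hMM, Matrix.mul_inv_rev, Matrix.mul_inv_rev]
    have h : R * A * R * (R⁻¹ * (T⁻¹ * R⁻¹)) = R * (A * T⁻¹) * R⁻¹ := by
      simp only [Matrix.mul_assoc, mul_nonsing_inv_cancel_left _ _ hRu]
    rw [h, trace_mul_cycle, nonsing_inv_mul _ hRu, Matrix.one_mul]
  have e3 : (R * T * R - M) * (R * T * R)⁻¹ * (R * T * R - M) =
      R * T * R - M - M + M * (R * T * R)⁻¹ * M := by
    generalize R * T * R = S at *
    simp only [Matrix.sub_mul, Matrix.mul_sub, mul_nonsing_inv _ hSu, Matrix.mul_assoc,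
      nonsing_inv_mul _ hSu, Matrix.one_mul, Matrix.mul_one]
    abel
  rw [e1, e2, e3]
  simp only [trace_add, trace_sub]
  ring

lemma PosDef.re_trace_mul_inv_mul_nonneg {S N : Matrix ι ι ℂ} (hS : S.PosDef)
    (hN : N.IsHermitian) : 0 ≤ (N * S⁻¹ * N).trace.re := by
  have h := hS.inv.posSemidef.conjTranspose_mul_mul_same N
  rw [hN.eq] at h
  exact (Complex.nonneg_iff.1 h.trace_nonneg).1

lemma PosDef.eq_zero_of_re_trace_mul_inv_mul_eq_zero {S N : Matrix ι ι ℂ} (hS : S.PosDef)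
    (hN : N.IsHermitian) (h0 : (N * S⁻¹ * N).trace.re = 0) : N = 0 := by
  have h := hS.inv.posSemidef.conjTranspose_mul_mul_same N
  rw [hN.eq] at h
  have h2 := h.trace_eq_zero_iff.1 (Complex.ext h0 (Complex.nonneg_iff.1 h.trace_nonneg).2.symm)
  have hR := hS.inv.cfcSqrt
  have hRR := CFC.sqrt_mul_sqrt_self _ hS.inv.posSemidef.nonneg
  generalize CFC.sqrt S⁻¹ = R at *
  have h3 : (R * N)ᴴ * (R * N) = 0 := by
    rw [conjTranspose_mul, hN.eq, hR.isHermitian.eq, ← h2, ← hRR]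
    simp only [Matrix.mul_assoc]
  rw [conjTranspose_mul_self_eq_zero] at h3
  rw [← nonsing_inv_mul_cancel_left R N ((isUnit_iff_isUnit_det _).1 hR.isUnit), h3,
    Matrix.mul_zero]

/-- The fidelity `tr (X^{1/2} A X^{1/2})^{1/2}` is a lower bound of
`(tr (X T) + tr (A T⁻¹)) / 2` over positive definite `T`. -/
lemma two_mul_re_trace_sqrt_le {X A T : Matrix ι ι ℂ} (hX : X.PosDef) (hA : A.PosDef)
    (hT : T.PosDef) :
    2 * (CFC.sqrt (CFC.sqrt X * A * CFC.sqrt X)).trace.re ≤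
      (X * T).trace.re + (A * T⁻¹).trace.re := by
  have h := congrArg Complex.re (trace_mul_add_trace_mul_inv_sub_two_mul_trace_sqrt hX hA hT)
  have h1 := (hX.cfcSqrt.mul_mul_self hT).re_trace_mul_inv_mul_nonneg
    ((hX.cfcSqrt.mul_mul_self hT).isHermitian.sub
      (hX.cfcSqrt.mul_mul_self hA).cfcSqrt.isHermitian)
  simp only [Complex.sub_re, Complex.add_re, Complex.mul_re, Complex.re_ofNat, Complex.im_ofNat,
    zero_mul, sub_zero] at h
  linarith

/-- Equality in `two_mul_re_trace_sqrt_le` characterises `T` as the optimal transport map. -/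
lemma two_mul_re_trace_sqrt_eq_iff {X A T : Matrix ι ι ℂ} (hX : X.PosDef) (hA : A.PosDef)
    (hT : T.PosDef) :
    2 * (CFC.sqrt (CFC.sqrt X * A * CFC.sqrt X)).trace.re =
      (X * T).trace.re + (A * T⁻¹).trace.re ↔ T * X * T = A := by
  have h := congrArg Complex.re (trace_mul_add_trace_mul_inv_sub_two_mul_trace_sqrt hX hA hT)
  have hR := hX.cfcSqrt
  have hRR := CFC.sqrt_mul_sqrt_self X hX.posSemidef.nonneg
  have hS := hR.mul_mul_self hT
  have hRA := hR.mul_mul_self hA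
  have hMM := CFC.sqrt_mul_sqrt_self _ hRA.posSemidef.nonneg
  have key : CFC.sqrt X * (T * X * T) * CFC.sqrt X =
      (CFC.sqrt X * T * CFC.sqrt X) * (CFC.sqrt X * T * CFC.sqrt X) := by
    generalize CFC.sqrt X = R at *
    rw [← hRR]
    simp only [Matrix.mul_assoc]
  simp only [Complex.sub_re, Complex.add_re, Complex.mul_re, Complex.re_ofNat, Complex.im_ofNat,
    zero_mul, sub_zero] at h
  refine ⟨fun h3 => ?_, fun h3 => ?_⟩
  · have h4 := sub_eq_zero.1 (hS.eq_zero_of_re_trace_mul_inv_mul_eq_zero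
      (hS.isHermitian.sub hRA.cfcSqrt.isHermitian) (by linarith))
    rw [← h4, ← key] at hMM
    exact hR.isUnit.mul_left_cancel (hR.isUnit.mul_right_cancel hMM)
  · have hM : CFC.sqrt (CFC.sqrt X * A * CFC.sqrt X) = CFC.sqrt X * T * CFC.sqrt X := by
      rw [← h3, key]
      exact CFC.sqrt_mul_self _ hS.posSemidef.nonneg
    rw [hM, sub_self] at h
    simp only [Matrix.mul_zero, trace_zero, Complex.zero_re] at h
    rw [hM]
    linarith

end Fidelity

end Matrix

lemma buresDist_sq {n : ℕ} {X A : Matrix (Fin n) (Fin n) ℂ} (hX : X.PosDef) (hA : A.PosDef) :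
    buresDist X A ^ 2 = X.trace.re + A.trace.re
      - 2 * (CFC.sqrt (CFC.sqrt X * A * CFC.sqrt X)).trace.re := by
  -- The choice `T = 1` shows that the bracket under the root is nonnegative.
  have h := Matrix.two_mul_re_trace_sqrt_le hX hA Matrix.PosDef.one
  rw [inv_one, mul_one, mul_one] at h
  exact Real.sq_sqrt (by linarith)

namespace Matrix

/-! ### Existence and stationarity for the dual problem -/

section DualProblem

open scoped Matrix.Norms.L2Operator
open Filter Topology

variable {ι κ : Type*} [Fintype ι] [DecidableEq ι] [Fintype κ]

lemma PosDef.exists_pos_smul_one_le {A : Matrix ι ι ℂ} (hA : A.PosDef) :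
    ∃ r : ℝ, 0 < r ∧ r • (1 : Matrix ι ι ℂ) ≤ A := by
  cases isEmpty_or_nonempty ι
  · exact ⟨1, one_pos, (Subsingleton.elim _ _).le⟩
  · obtain ⟨r, hr, h⟩ := (CFC.exists_pos_algebraMap_le_iff (a := A) hA.isHermitian).2
      (fun x hx => by
        rw [hA.isHermitian.spectrum_real_eq_range_eigenvalues] at hx
        obtain ⟨i, rfl⟩ := hx
        exact hA.eigenvalues_pos i)
    exact ⟨r, hr, by rwa [Algebra.algebraMap_eq_smul_one] at h⟩

lemma PosDef.of_smul_one_le {ι : Type*} [DecidableEq ι] {T : Matrix ι ι ℂ} {r : ℝ} (hr : 0 < r)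
    (h : r • (1 : Matrix ι ι ℂ) ≤ T) : T.PosDef := by
  have h1 := (PosDef.one (n := ι) (R := ℂ)).smul hr |>.add_posSemidef (le_iff.1 h)
  rwa [add_sub_cancel] at h1

lemma PosSemidef.le_re_trace_smul_one {P : Matrix ι ι ℂ} (hP : P.PosSemidef) :
    P ≤ P.trace.re • (1 : Matrix ι ι ℂ) := by
  rw [← Algebra.algebraMap_eq_smul_one]
  refine le_algebraMap_of_spectrum_le (fun x hx => ?_) hP.isHermitian
  rw [hP.isHermitian.spectrum_real_eq_range_eigenvalues] at hx
  obtain ⟨i, rfl⟩ := hx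
  rw [hP.isHermitian.trace_eq_sum_eigenvalues, Complex.re_sum]
  exact Finset.single_le_sum (f := fun i => ((hP.isHermitian.eigenvalues i : ℂ)).re)
    (fun j _ => hP.eigenvalues_nonneg j) (Finset.mem_univ i)

lemma PosSemidef.re_trace_mul_nonneg {P Q : Matrix ι ι ℂ} (hP : P.PosSemidef)
    (hQ : Q.PosSemidef) : 0 ≤ (P * Q).trace.re := by
  have hR := (nonneg_iff_posSemidef.1 (CFC.sqrt_nonneg Q))
  have h := hP.conjTranspose_mul_mul_same (CFC.sqrt Q)
  rw [hR.isHermitian.eq] at h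
  have h0 := (Complex.nonneg_iff.1 h.trace_nonneg).1
  rwa [trace_mul_cycle, trace_mul_comm, CFC.sqrt_mul_sqrt_self Q hQ.nonneg] at h0

/-- Coercivity: `r tr T⁻¹ ≤ tr (A T⁻¹) ≤ c`, and the trace dominates the largest eigenvalue, so `T⁻¹
≤ c / r`. Conjugating by `T^{1/2}` inverts this. -/
lemma PosDef.smul_one_le_of_re_trace_mul_inv_le {A T : Matrix ι ι ℂ} {r c : ℝ} (hr : 0 < r)
    (hc : 0 < c) (hA : r • (1 : Matrix ι ι ℂ) ≤ A) (hT : T.PosDef)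
    (h : (A * T⁻¹).trace.re ≤ c) : (r / c) • (1 : Matrix ι ι ℂ) ≤ T := by
  have h1 := (le_iff.1 hA).re_trace_mul_nonneg hT.inv.posSemidef
  rw [Matrix.sub_mul, trace_sub, Matrix.smul_mul, Matrix.one_mul, trace_smul, Complex.sub_re,
    Complex.smul_re, smul_eq_mul] at h1
  have h2 : T⁻¹ ≤ (c / r) • (1 : Matrix ι ι ℂ) := by
    refine hT.inv.posSemidef.le_re_trace_smul_one.trans ?_
    refine smul_le_smul_of_nonneg_right ?_ PosSemidef.one.nonneg
    rw [le_div_iff₀ hr]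
    linarith
  have hR := hT.cfcSqrt
  have hRR := CFC.sqrt_mul_sqrt_self T hT.posSemidef.nonneg
  have h3 := (le_iff.1 h2).conjTranspose_mul_mul_same (CFC.sqrt T)
  have hRu := (isUnit_iff_isUnit_det _).1 hR.isUnit
  rw [hR.isHermitian.eq] at h3
  generalize CFC.sqrt T = R at *
  have h4 : R * ((c / r) • (1 : Matrix ι ι ℂ) - T⁻¹) * R = (c / r) • T - 1 := by
    rw [← hRR, Matrix.mul_inv_rev, Matrix.mul_sub, Matrix.sub_mul,
      mul_nonsing_inv_cancel_left _ _ hRu, nonsing_inv_mul _ hRu, Matrix.mul_smul,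
      Matrix.smul_mul, Matrix.mul_one]
  rw [h4] at h3
  have h5 := h3.smul (div_pos hr hc).le
  rw [smul_sub, smul_smul, div_mul_div_comm, mul_comm r c, div_self (by positivity), one_smul] at h5
  exact le_iff.2 h5

lemma continuousAt_inv {T : Matrix ι ι ℂ} (hT : IsUnit T) :
    ContinuousAt (fun S : Matrix ι ι ℂ => S⁻¹) T := by
  obtain ⟨u, rfl⟩ := hT
  have h := NormedRing.inverse_continuousAt u
  refine h.congr (Eventually.of_forall fun S => ?_)
  exact (nonsing_inv_eq_ringInverse S).symm

/-- Compactness: feasible points no worse than the constant family `1` stay uniformly away from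
singular matrices by coercivity, while the constraint gives `S j ≤ (w j)⁻¹`. -/
lemma exists_min_sum_trace_mul_inv {w : κ → ℝ} {A : κ → Matrix ι ι ℂ} (hA : ∀ j, (A j).PosDef)
    (hw : ∀ j, 0 < w j) (hw1 : ∑ j, w j = 1) :
    ∃ T : κ → Matrix ι ι ℂ, (∀ j, (T j).PosDef) ∧ ∑ j, w j • T j = 1 ∧
      ∀ S : κ → Matrix ι ι ℂ, (∀ j, (S j).PosDef) → ∑ j, w j • S j = 1 →
        ∑ j, w j * (A j * (T j)⁻¹).trace.re ≤ ∑ j, w j * (A j * (S j)⁻¹).trace.re := by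
  choose r hr hrA using fun j => (hA j).exists_pos_smul_one_le
  set G : (κ → Matrix ι ι ℂ) → ℝ := fun T => ∑ j, w j * (A j * (T j)⁻¹).trace.re with hG
  have hone : ∑ j, w j • (1 : Matrix ι ι ℂ) = 1 := by rw [← Finset.sum_smul, hw1, one_smul]
  have hpos : ∀ S : κ → Matrix ι ι ℂ, (∀ j, (S j).PosDef) → ∀ j,
      0 ≤ w j * (A j * (S j)⁻¹).trace.re := fun S hS j =>
    mul_nonneg (hw j).le ((hA j).posSemidef.re_trace_mul_nonneg (hS j).inv.posSemidef)
  have hG0 : 0 ≤ G 1 := Finset.sum_nonneg fun j _ => hpos 1 (fun _ => PosDef.one) j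
  -- The `+ 1` keeps the bound positive for `0 × 0` matrices, where `G 1 = 0`.
  have hc : ∀ j, 0 < (G 1 + 1) / w j := fun j => div_pos (by linarith) (hw j)
  have hsub : ∀ S : κ → Matrix ι ι ℂ, (∀ j, (S j).PosDef) → G S ≤ G 1 → ∀ j,
      (r j / ((G 1 + 1) / w j)) • (1 : Matrix ι ι ℂ) ≤ S j := fun S hS hGS j => by
    refine PosDef.smul_one_le_of_re_trace_mul_inv_le (hr j) (hc j) (hrA j) (hS j) ?_
    have h := Finset.single_le_sum (fun j _ => hpos S hS j) (Finset.mem_univ j)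
    rw [le_div_iff₀ (hw j)]
    have : w j * (A j * (S j)⁻¹).trace.re ≤ G S := h
    linarith
  set K : Set (κ → Matrix ι ι ℂ) := {S | ∑ j, w j • S j = 1} ∩
    ⋂ j, {S | (r j / ((G 1 + 1) / w j)) • (1 : Matrix ι ι ℂ) ≤ S j} with hK
  have hKpos : ∀ S ∈ K, ∀ j, (S j).PosDef := fun S hS j =>
    PosDef.of_smul_one_le (div_pos (hr j) (hc j)) (Set.mem_iInter.1 hS.2 j)
  have hKclosed : IsClosed K := by
    refine IsClosed.inter (isClosed_eq (by fun_prop) continuous_const) ?_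
    exact isClosed_iInter fun j => isClosed_le continuous_const (continuous_apply j)
  have hKbdd : Bornology.IsBounded K := by
    refine (Metric.isBounded_closedBall (x := (0 : κ → Matrix ι ι ℂ))
      (r := ∑ j, ‖(w j)⁻¹ • (1 : Matrix ι ι ℂ)‖)).subset fun S hS => ?_
    rw [mem_closedBall_zero_iff, pi_norm_le_iff_of_nonneg (by positivity)]
    intro j
    refine le_trans ?_ (Finset.single_le_sum (f := fun j => ‖(w j)⁻¹ • (1 : Matrix ι ι ℂ)‖)
      (fun _ _ => norm_nonneg _) (Finset.mem_univ j))
    refine CStarAlgebra.norm_le_norm_of_nonneg_of_le (hKpos S hS j).posSemidef.nonneg ?_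
    have h : w j • S j ≤ 1 := by
      have hS1 : ∑ j, w j • S j = 1 := hS.1
      rw [← hS1]
      exact Finset.single_le_sum (f := fun j => w j • S j)
        (fun i _ => ((hKpos S hS i).posSemidef.smul (hw i).le).nonneg) (Finset.mem_univ j)
    have h2 := smul_le_smul_of_nonneg_left h (inv_nonneg.2 (hw j).le)
    rwa [smul_smul, inv_mul_cancel₀ (hw j).ne', one_smul] at h2
  have : ProperSpace (κ → Matrix ι ι ℂ) := FiniteDimensional.proper ℂ _
  have hKc : IsCompact K := Metric.isCompact_of_isClosed_isBounded hKclosed hKbdd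
  have h1K : (1 : κ → Matrix ι ι ℂ) ∈ K :=
    ⟨hone, Set.mem_iInter.2 (hsub 1 (fun _ => PosDef.one) le_rfl)⟩
  have hcont : ContinuousOn G K := by
    intro S hS
    refine ContinuousAt.continuousWithinAt ?_
    refine tendsto_finsetSum _ fun j _ => ?_
    have h1 : ContinuousAt (fun S : κ → Matrix ι ι ℂ => (S j)⁻¹) S :=
      ContinuousAt.comp (f := fun S : κ → Matrix ι ι ℂ => S j)
        (continuousAt_inv (hKpos S hS j).isUnit) (continuous_apply j).continuousAt
    have h2 : Continuous fun B : Matrix ι ι ℂ => w j * (A j * B).trace.re := by fun_prop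
    exact ContinuousAt.comp (g := fun B : Matrix ι ι ℂ => w j * (A j * B).trace.re)
      h2.continuousAt h1
  obtain ⟨T, hT, hmin⟩ := hKc.exists_isMinOn ⟨1, h1K⟩ hcont
  refine ⟨T, hKpos T hT, hT.1, fun S hS hS1 => ?_⟩
  by_cases h : G S ≤ G 1
  · exact hmin (show S ∈ K from ⟨hS1, Set.mem_iInter.2 (hsub S hS h)⟩)
  · exact (hmin h1K).trans (not_le.1 h).le

lemma PosDef.eventually_add_smul {T H : Matrix ι ι ℂ} (hT : T.PosDef) (hH : H.IsHermitian) :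
    ∀ᶠ s : ℝ in 𝓝 0, (T + s • H).PosDef := by
  obtain ⟨r, hr, h⟩ := hT.exists_pos_smul_one_le
  have hlim : Tendsto (fun s : ℝ => ‖s • H‖) (𝓝 0) (𝓝 0) := by
    have hcont : Continuous fun s : ℝ => ‖s • H‖ := by fun_prop
    simpa using hcont.tendsto 0
  filter_upwards [hlim.eventually_lt_const hr] with s hs
  refine PosDef.of_smul_one_le (r := r - ‖s • H‖) (by linarith) ?_
  have hsH : IsSelfAdjoint (s • H) := (IsSelfAdjoint.all s).smul hH
  have h1 := hsH.neg_algebraMap_norm_le_self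
  rw [Algebra.algebraMap_eq_smul_one] at h1
  rw [sub_smul, sub_eq_add_neg]
  exact add_le_add h h1

lemma hasDerivAt_re_trace_mul_inv {A T H : Matrix ι ι ℂ} (hT : IsUnit T) :
    HasDerivAt (fun s : ℝ => (A * (T + s • H)⁻¹).trace.re)
      (-(T⁻¹ * A * T⁻¹ * H).trace.re) 0 := by
  obtain ⟨u, rfl⟩ := hT
  have hu : ((u⁻¹ : (Matrix ι ι ℂ)ˣ) : Matrix ι ι ℂ) = (u : Matrix ι ι ℂ)⁻¹ := coe_units_inv u
  have h1 : HasDerivAt (fun s : ℝ => (u : Matrix ι ι ℂ) + s • H) H 0 := by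
    simpa using ((hasDerivAt_id (0 : ℝ)).smul_const H).const_add (u : Matrix ι ι ℂ)
  have h2 := hasFDerivAt_ringInverse (𝕜 := ℝ) u
  have h3 := HasFDerivAt.comp_hasDerivAt_of_eq (0 : ℝ) h2 h1 (by simp)
  let L : Matrix ι ι ℂ →L[ℝ] ℝ := LinearMap.toContinuousLinearMap
    { toFun := fun B => (A * B).trace.re
      map_add' := fun B C => by rw [Matrix.mul_add, trace_add, Complex.add_re]
      map_smul' := fun c B => by
        rw [Matrix.mul_smul, trace_smul, Complex.smul_re, RingHom.id_apply] }
  have h4 := L.hasFDerivAt.comp_hasDerivAt (0 : ℝ) h3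
  convert! h4 using 1
  · funext s
    simp [L, nonsing_inv_eq_ringInverse]
  · have h5 : ((u : Matrix ι ι ℂ)⁻¹ * A * (u : Matrix ι ι ℂ)⁻¹ * H).trace =
        (A * ((u : Matrix ι ι ℂ)⁻¹ * H * (u : Matrix ι ι ℂ)⁻¹)).trace := by
      rw [Matrix.mul_assoc, Matrix.mul_assoc, trace_mul_comm]
      simp only [Matrix.mul_assoc]
    simp [L, h5, hu]

/-- The dual of the barycentre problem: optimal transport maps from a common `X` to the `A j` whose
weighted mean is the identity. -/
lemma exists_posDef_sum_smul_eq_one_and_mul_mul_eq {w : κ → ℝ} {A : κ → Matrix ι ι ℂ}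
    (hA : ∀ j, (A j).PosDef) (hw : ∀ j, 0 < w j) (hw1 : ∑ j, w j = 1) :
    ∃ (X : Matrix ι ι ℂ) (T : κ → Matrix ι ι ℂ), X.PosDef ∧ (∀ j, (T j).PosDef) ∧
      ∑ j, w j • T j = 1 ∧ ∀ j, T j * X * T j = A j := by
  obtain ⟨T, hT, hT1, hmin⟩ := exists_min_sum_trace_mul_inv hA hw hw1
  set Y : κ → Matrix ι ι ℂ := fun j => (T j)⁻¹ * A j * (T j)⁻¹ with hY
  have hYpos : ∀ j, (Y j).PosDef := fun j => (hT j).inv.mul_mul_self (hA j)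
  set X : Matrix ι ι ℂ := ∑ j, w j • Y j with hX
  -- The negative gradient `Y`, projected onto directions preserving the constraint.
  set H : κ → Matrix ι ι ℂ := fun j => Y j - X with hH
  have hXh : X.IsHermitian := by
    rw [hX, IsHermitian, conjTranspose_sum]
    exact Finset.sum_congr rfl fun j _ => ((hYpos j).posSemidef.smul (hw j).le).isHermitian
  have hHh : ∀ j, (H j).IsHermitian := fun j => (hYpos j).isHermitian.sub hXh
  have hHsum : ∑ j, w j • H j = 0 := by
    simp only [hH, smul_sub, Finset.sum_sub_distrib, ← Finset.sum_smul, hw1, one_smul]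
    exact sub_self _
  have hlocal : IsLocalMin
      (fun s : ℝ => ∑ j, w j * (A j * (T j + s • H j)⁻¹).trace.re) 0 := by
    filter_upwards [eventually_all.2 fun j => (hT j).eventually_add_smul (hHh j)] with s hs
    simp only [zero_smul, add_zero]
    refine hmin _ hs ?_
    simp only [smul_add, Finset.sum_add_distrib, hT1, smul_comm (w _) s, ← Finset.smul_sum, hHsum,
      smul_zero, add_zero]
  have hderiv := HasDerivAt.fun_sum (u := Finset.univ) fun j _ =>
    (hasDerivAt_re_trace_mul_inv (A := A j) (H := H j) (hT j).isUnit).const_mul (w j)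
  have h0 := hlocal.hasDerivAt_eq_zero hderiv
  have hXH : ∑ j, w j * (X * H j).trace.re = 0 := by
    have h := congrArg (fun B => (X * B).trace.re) hHsum
    simpa [Matrix.mul_sum, trace_sum] using h
  -- The derivative along `H` is `-∑ w j tr (Y j H j)`; as `∑ w j • H j = 0`, replacing `Y j` by `H
  -- j` changes nothing.
  have hHH : ∑ j, w j * (H j * H j).trace.re = 0 := by
    have h : ∀ j, w j * (H j * H j).trace.re =
        -(w j * -((T j)⁻¹ * A j * (T j)⁻¹ * H j).trace.re) - w j * (X * H j).trace.re := fun j => by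
      have : H j * H j = Y j * H j - X * H j := Matrix.sub_mul _ _ _
      rw [this, trace_sub, Complex.sub_re]
      ring
    simp only [h, Finset.sum_sub_distrib, Finset.sum_neg_distrib, hXH, h0, neg_zero, sub_zero]
  have hnonneg : ∀ j, 0 ≤ (H j * H j).trace.re := fun j => by
    have h := (PosDef.one (n := ι) (R := ℂ)).re_trace_mul_inv_mul_nonneg (hHh j)
    rwa [inv_one, Matrix.mul_one] at h
  have hHzero : ∀ j, H j = 0 := fun j => by
    have h := (Finset.sum_eq_zero_iff_of_nonneg
      fun j _ => mul_nonneg (hw j).le (hnonneg j)).1 hHH j (Finset.mem_univ j)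
    refine (PosDef.one (n := ι) (R := ℂ)).eq_zero_of_re_trace_mul_inv_mul_eq_zero (hHh j) ?_
    rw [inv_one, Matrix.mul_one]
    exact (mul_eq_zero.1 h).resolve_left (hw j).ne'
  have hYX : ∀ j, Y j = X := fun j => sub_eq_zero.1 (hHzero j)
  have hκ : Nonempty κ := by
    by_contra hne
    rw [not_nonempty_iff] at hne
    simp at hw1
  refine ⟨X, T, hYX hκ.some ▸ hYpos _, hT, hT1, fun j => ?_⟩
  have hu := (isUnit_iff_isUnit_det _).1 (hT j).isUnit
  rw [← hYX j, hY]
  simp only [Matrix.mul_assoc, mul_nonsing_inv_cancel_left _ _ hu, nonsing_inv_mul _ hu,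
    Matrix.mul_one]

end DualProblem

end Matrix

/-! ### Optimality, uniqueness and the Loewner bound -/

section Barycentre

variable {n m : ℕ} {w : Fin m → ℝ} {A T : Fin m → Matrix (Fin n) (Fin n) ℂ}
  {X Y : Matrix (Fin n) (Fin n) ℂ}

lemma sum_re_trace_mul_eq (hT1 : ∑ j, w j • T j = 1) (Y : Matrix (Fin n) (Fin n) ℂ) :
    ∑ j, w j * (Y * T j).trace.re = Y.trace.re := by
  have h := congrArg (fun B => (Y * B).trace.re) hT1
  simpa [Matrix.mul_sum, Matrix.trace_sum] using h

/-- Deficit of the barycentre functional at `Y` above the dual bound. -/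
lemma sum_mul_buresDist_sq_eq (hw1 : ∑ j, w j = 1) (hA : ∀ j, (A j).PosDef)
    (hT1 : ∑ j, w j • T j = 1) (hY : Y.PosDef) :
    ∑ j, w j * buresDist Y (A j) ^ 2 =
      ∑ j, w j * ((A j).trace.re - (A j * (T j)⁻¹).trace.re) +
      ∑ j, w j * ((Y * T j).trace.re + (A j * (T j)⁻¹).trace.re -
        2 * (CFC.sqrt (CFC.sqrt Y * A j * CFC.sqrt Y)).trace.re) := by
  have h1 : ∑ j, w j * Y.trace.re = ∑ j, w j * (Y * T j).trace.re := by
    rw [sum_re_trace_mul_eq hT1, ← Finset.sum_mul, hw1, one_mul]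
  have h2 : ∀ j, w j * buresDist Y (A j) ^ 2 = w j * Y.trace.re +
      w j * ((A j).trace.re - 2 * (CFC.sqrt (CFC.sqrt Y * A j * CFC.sqrt Y)).trace.re) :=
    fun j => by rw [buresDist_sq hY (hA j)]; ring
  simp only [h2, Finset.sum_add_distrib, h1]
  simp only [← Finset.sum_add_distrib]
  exact Finset.sum_congr rfl fun j _ => by ring

lemma sum_mul_buresDist_sq_le_of_transport (hA : ∀ j, (A j).PosDef) (hw : ∀ j, 0 < w j)
    (hw1 : ∑ j, w j = 1) (hX : X.PosDef) (hT : ∀ j, (T j).PosDef) (hT1 : ∑ j, w j • T j = 1)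
    (hTX : ∀ j, T j * X * T j = A j) (hY : Y.PosDef) :
    ∑ j, w j * buresDist X (A j) ^ 2 ≤ ∑ j, w j * buresDist Y (A j) ^ 2 := by
  rw [sum_mul_buresDist_sq_eq hw1 hA hT1 hX, sum_mul_buresDist_sq_eq hw1 hA hT1 hY]
  refine add_le_add_right (Finset.sum_le_sum fun j _ => ?_) _
  refine mul_le_mul_of_nonneg_left ?_ (hw j).le
  have h1 := (Matrix.two_mul_re_trace_sqrt_eq_iff hX (hA j) (hT j)).2 (hTX j)
  have h2 := Matrix.two_mul_re_trace_sqrt_le hY (hA j) (hT j)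
  linarith

lemma eq_of_sum_mul_buresDist_sq_le (hA : ∀ j, (A j).PosDef) (hw : ∀ j, 0 < w j)
    (hw1 : ∑ j, w j = 1) (hX : X.PosDef) (hT : ∀ j, (T j).PosDef) (hT1 : ∑ j, w j • T j = 1)
    (hTX : ∀ j, T j * X * T j = A j) (hY : Y.PosDef)
    (hle : ∑ j, w j * buresDist Y (A j) ^ 2 ≤ ∑ j, w j * buresDist X (A j) ^ 2) : Y = X := by
  rw [sum_mul_buresDist_sq_eq hw1 hA hT1 hX, sum_mul_buresDist_sq_eq hw1 hA hT1 hY,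
    add_le_add_iff_left] at hle
  have hX0 : ∑ j, w j * ((X * T j).trace.re + (A j * (T j)⁻¹).trace.re -
      2 * (CFC.sqrt (CFC.sqrt X * A j * CFC.sqrt X)).trace.re) = 0 :=
    Finset.sum_eq_zero fun j _ => by
      rw [(Matrix.two_mul_re_trace_sqrt_eq_iff hX (hA j) (hT j)).2 (hTX j), sub_self, mul_zero]
  have hnonneg : ∀ j, 0 ≤ w j * ((Y * T j).trace.re + (A j * (T j)⁻¹).trace.re -
      2 * (CFC.sqrt (CFC.sqrt Y * A j * CFC.sqrt Y)).trace.re) := fun j =>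
    mul_nonneg (hw j).le (sub_nonneg.2 (Matrix.two_mul_re_trace_sqrt_le hY (hA j) (hT j)))
  rw [hX0] at hle
  have h0 := (Finset.sum_eq_zero_iff_of_nonneg fun j _ => hnonneg j).1
    (hle.antisymm (Finset.sum_nonneg fun j _ => hnonneg j))
  obtain ⟨j⟩ : Nonempty (Fin m) := by
    by_contra hne
    rw [not_nonempty_iff] at hne
    simp at hw1
  -- One index suffices: `T j Y T j = A j = T j X T j`, and `T j` cancels.
  have hj := (mul_eq_zero.1 (h0 j (Finset.mem_univ j))).resolve_left (hw j).ne'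
  have h := (Matrix.two_mul_re_trace_sqrt_eq_iff hY (hA j) (hT j)).1 (sub_eq_zero.1 hj).symm
  exact (hT j).isUnit.mul_left_cancel ((hT j).isUnit.mul_right_cancel (h.trans (hTX j).symm))

/-- Operator convexity of `T ↦ T X T`, at weighted mean `1`. -/
lemma le_sum_smul_of_transport (hw : ∀ j, 0 < w j) (hw1 : ∑ j, w j = 1) (hX : X.PosDef)
    (hT : ∀ j, (T j).PosDef) (hT1 : ∑ j, w j • T j = 1) (hTX : ∀ j, T j * X * T j = A j) :
    X ≤ ∑ j, w j • A j := by
  have hpos : (∑ j, w j • ((T j - 1) * X * (T j - 1))).PosSemidef :=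
    Matrix.posSemidef_sum _ fun j _ => by
      have h := hX.posSemidef.conjTranspose_mul_mul_same (T j - 1)
      rw [((hT j).isHermitian.sub Matrix.isHermitian_one).eq] at h
      exact h.smul (hw j).le
  have hexp : ∀ j, w j • ((T j - 1) * X * (T j - 1)) =
      w j • A j - (w j • T j) * X - X * (w j • T j) + w j • X := fun j => by
    rw [← hTX j, smul_mul_assoc, mul_smul_comm, ← smul_sub, ← smul_sub, ← smul_add]
    congr 1
    noncomm_ring
  have hsum : ∑ j, w j • ((T j - 1) * X * (T j - 1)) = ∑ j, w j • A j - X := by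
    simp only [hexp, Finset.sum_add_distrib, Finset.sum_sub_distrib, ← Finset.sum_mul,
      ← Finset.mul_sum, hT1, ← Finset.sum_smul, hw1, one_smul, one_mul, mul_one]
    abel
  rwa [hsum, ← Matrix.le_iff] at hpos

end Barycentre

/-- The Wasserstein barycentre of positive definite matrices is well defined (it is the unique
minimiser) and lies below the weighted arithmetic mean in the Loewner order. -/
theorem theorem9 (n m : ℕ) (A : Fin m → Matrix (Fin n) (Fin n) ℂ) (w : Fin m → ℝ)
    (hA : ∀ j, (A j).PosDef) (hw : ∀ j, 0 < w j) (hw1 : ∑ j, w j = 1) :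
    IsWassersteinMinimiser w A (wassersteinBarycentre w A) ∧
    (∀ X : Matrix (Fin n) (Fin n) ℂ, IsWassersteinMinimiser w A X →
      X = wassersteinBarycentre w A) ∧
    wassersteinBarycentre w A ≤ ∑ j, w j • A j := by
  obtain ⟨X, T, hX, hT, hT1, hTX⟩ :=
    Matrix.exists_posDef_sum_smul_eq_one_and_mul_mul_eq hA hw hw1
  have hmin : IsWassersteinMinimiser w A X :=
    ⟨hX, fun Y hY => sum_mul_buresDist_sq_le_of_transport hA hw hw1 hX hT hT1 hTX hY⟩
  have huniq : ∀ Y, IsWassersteinMinimiser w A Y → Y = X := fun Y hY =>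
    eq_of_sum_mul_buresDist_sq_le hA hw hw1 hX hT hT1 hTX hY.1 (hY.2 X hX)
  have hbar : IsWassersteinMinimiser w A (wassersteinBarycentre w A) :=
    Classical.epsilon_spec ⟨X, hmin⟩
  rw [huniq _ hbar]
  exact ⟨hmin, huniq, le_sum_smul_of_transport hw hw1 hX hT hT1 hTX⟩
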